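/- Let $A$ be a finite alphabet. A class of languages over $A$ is a set $\mathcal{C}$ of subsets of $A^*$. It is a \emph{lattice} if it contains $\emptyset$ and $A^*$ and is closed under union and intersection; it is \emph{quotienting} if for all $L \in \mathcal{C}$ and $u \in A^*$ the languages $u^{-1}L = \{w \in A^* \mid uw \in L\}$ and $Lu^{-1} = \{w \in A^* \mid wu \in L\}$ belong to $\mathcal{C}$. The \emph{polynomial closure} $\mathrm{Pol}(\mathcal{C})$ is the smallest class that contains $\mathcal{C}$ and is closed under union and under marked concatenation ($K, L \in \mathrm{Pol}(\mathcal{C})$ and $a \in A$ imply $KaL \in \mathrm{Pol}(\mathcal{C})$), and $\text{co-Pol}(\mathcal{C})$ is the class of all languages $L$ such that $A^* \setminus L \in \mathrm{Pol}(\mathcal{C})$. For a class $\mathcal{D}$, \emph{$\mathcal{D}$-membership} is the problem of deciding, given a regular language $L \subseteq A^*$ (by a nondeterministic finite automaton), whether $L \in \mathcal{D}$. \textbf{Theorem.} Let $\mathcal{C}$ be a quotienting lattice of regular languages over $A$. If $\mathcal{C}$-membership is decidable, then $(\mathrm{Pol}(\mathcal{C}) \cap \text{co-Pol}(\mathcal{C}))$-membership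 is decidable. -/

import Mathlib

/-- A lattice of languages over `A`: a class (set) of languages containing the empty language
and the universal language, and closed under union and intersection. -/
structure IsLanguageLattice {A : Type*} (C : Set (Language A)) : Prop where
  bot_mem : (⊥ : Language A) ∈ C
  top_mem : (⊤ : Language A) ∈ C
  union_mem : ∀ K ∈ C, ∀ L ∈ C, K ⊔ L ∈ C
  inter_mem : ∀ K ∈ C, ∀ L ∈ C, K ⊓ L ∈ C

/-- The right quotient `L u⁻¹ = {w | w u ∈ L}`. (The left quotient `u⁻¹ L = {w | u w ∈ L}` is
`Language.leftQuotient`.) -/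
def languageRightQuotient {A : Type*} (L : Language A) (u : List A) : Language A :=
  {w : List A | w ++ u ∈ L}

/-- A quotienting lattice of regular languages over `A`: a lattice of languages, all of them
regular, that is closed under left and right quotients by words. -/
structure IsQuotientingLatticeOfRegular {A : Type*} (C : Set (Language A)) : Prop extends
    IsLanguageLattice C where
  regular : ∀ L ∈ C, L.IsRegular
  leftQuotient_mem : ∀ L ∈ C, ∀ u : List A, L.leftQuotient u ∈ C
  rightQuotient_mem : ∀ L ∈ C, ∀ u : List A, languageRightQuotient L u ∈ C

/-- Membership in the polynomial closure of `C`: the smallest class of languages that contains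
`C` and is closed under union and under marked concatenation `K, L ↦ K a L`, `a ∈ A`. -/
inductive InPol {A : Type*} (C : Set (Language A)) : Language A → Prop
  | base (L : Language A) : L ∈ C → InPol C L
  | union (K L : Language A) : InPol C K → InPol C L → InPol C (K ⊔ L)
  | markedConcat (K L : Language A) (a : A) :
      InPol C K → InPol C L → InPol C (K * ({[a]} : Language A) * L)

/-- The polynomial closure `Pol(C)`. -/
def Pol {A : Type*} (C : Set (Language A)) : Set (Language A) := {L | InPol C L}

/-- `co-Pol(C)`: the languages whose complement is in `Pol(C)`. -/
def coPol {A : Type*} (C : Set (Language A)) : Set (Language A) := {L | Lᶜ ∈ Pol C}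

/-- A finite description `(I, Δ, F)` of a nondeterministic finite automaton over `A`, whose states
are natural numbers: the lists of its initial states, of its transitions `(p, a, q)` (read `a` in
state `p`, go to state `q`), and of its accepting states. Every such triple is an automaton. -/
abbrev NFACode (A : Type*) : Type _ := List ℕ × List (ℕ × A × ℕ) × List ℕ

namespace NFACode

/-- The automaton described by a code. Only the finitely many states listed in the code matter. -/
def toNFA {A : Type*} (c : NFACode A) : NFA A ℕ where
  start := {q | q ∈ c.1}
  step p a := {q | (p, a, q) ∈ c.2.1}
  accept := {q | q ∈ c.2.2}

/-- The language accepted by the automaton described by a code. -/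
def language {A : Type*} (c : NFACode A) : Language A := c.toNFA.accepts

end NFACode

/-- Decidability of the membership problem of a class `C` of languages over `A`: there is an
algorithm that takes a regular language `L`, given by a nondeterministic finite automaton, and
tells whether `L ∈ C`. -/
def MembershipDecidable {A : Type*} [Primcodable A] (C : Set (Language A)) : Prop :=
  ComputablePred fun c : NFACode A => c.language ∈ C

/-- The codes describe exactly the regular languages. -/
theorem NFACode.isRegular_iff_exists_code {A : Type*} [Finite A] (L : Language A) :
    L.IsRegular ↔ ∃ c : NFACode A, c.language = L := by
  constructor
  · intro h
    obtain ⟨σ, hσ, M, rfl⟩ := h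
    classical
    have := Fintype.ofFinite A
    obtain ⟨n, ⟨e⟩⟩ := Finite.exists_equiv_fin σ
    let g : σ → ℕ := fun s => (e s : ℕ)
    have hg : Function.Injective g := fun a b hab => e.injective (Fin.ext hab)
    let c : NFACode A := ([g M.start],
      (Finset.univ : Finset (σ × A)).toList.map (fun x => (g x.1, x.2, g (M.step x.1 x.2))),
      ((Finset.univ : Finset σ).filter (· ∈ M.accept)).toList.map g)
    refine ⟨c, ?_⟩
    have hs : c.toNFA.start = {g M.start} := by
      ext q; simp [NFACode.toNFA, c]
    have hst : ∀ s a, c.toNFA.step (g s) a = {g (M.step s a)} := by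
      intro s a
      ext q
      simp only [NFACode.toNFA, c, Set.mem_ofPred_eq, List.mem_map, Finset.mem_toList,
        Finset.mem_univ, true_and, Prod.mk.injEq, Set.mem_singleton_iff, Prod.exists]
      constructor
      · rintro ⟨s', a', h1, rfl, rfl⟩
        rw [hg h1]
      · rintro rfl
        exact ⟨s, a, rfl, rfl, rfl⟩
    have hev : ∀ (w : List A) (s : σ), c.toNFA.evalFrom {g s} w = {g (M.evalFrom s w)} := by
      intro w
      induction w with
      | nil => intro s; simp
      | cons a w ih =>
        intro s
        rw [NFA.evalFrom_cons, NFA.stepSet_singleton, hst, ih, DFA.evalFrom_cons]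
    ext w
    rw [NFACode.language, NFA.mem_accepts, hs, hev, DFA.mem_accepts]
    simp only [Set.mem_singleton_iff, exists_eq_right, DFA.eval]
    simp only [NFACode.toNFA, c, Set.mem_ofPred_eq, List.mem_map, Finset.mem_toList,
      Finset.mem_filter, Finset.mem_univ, true_and]
    constructor
    · rintro ⟨s, h1, h2⟩
      rwa [← hg h2]
    · intro h
      exact ⟨_, h, rfl⟩
  · rintro ⟨c, rfl⟩
    rw [Language.isRegular_iff_finite_range_leftQuotient, NFACode.language,
      ← NFA.toDFA_correct, Language.leftQuotient_accepts, Set.range_comp]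
    apply Set.Finite.image
    have hfin : ({q | q ∈ c.1} ∪ {q | ∃ p a, (p, a, q) ∈ c.2.1} : Set ℕ).Finite := by
      refine Set.Finite.union (List.finite_toSet c.1) ?_
      refine ((List.finite_toSet c.2.1).image (fun x => x.2.2)).subset ?_
      rintro q ⟨p, a, h⟩
      exact ⟨_, h, rfl⟩
    refine hfin.finite_subsets.subset ?_
    rintro _ ⟨w, rfl⟩
    induction w using List.reverseRecOn with
    | nil => exact Set.subset_union_left
    | append_singleton w a _ =>
      rw [DFA.eval_append_singleton]
      intro q hq
      change q ∈ c.toNFA.stepSet _ a at hq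
      rw [NFA.mem_stepSet] at hq
      obtain ⟨p, _, hp⟩ := hq
      exact Or.inr ⟨p, a, hp⟩

/-!
Let `L` be a regular language with syntactic morphism `φ`. Then `L` is in `Pol(C) ∩ co-Pol(C)` if
and only if, for every idempotent `e` of the syntactic monoid, the language of the words `w` with
`e φ(w) e = e` is in `C`.

*Sufficiency.* Call `H` coverable if, for each `m`, the words of `H` with value `m` are contained in
a language of `Pol(C)` all of whose words have value `m`. The coverable languages are closed under
union and product, and under the star of languages `H` with a single idempotent value `e`, because
`H∗ = 1 + H + H H∗ H` and the words of `H∗` satisfy `e φ(w) e = e`. By Simon's factorization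
argument, these operations generate all languages from the letters.

*Necessity.* In a language of `Pol(C)`, a factor `e` of a word can be pumped into a large power of
`e w e`, where one occurrence of `w` can then be replaced by any `w'` that belongs to the same
quotients of finitely many languages of `C`. If `e w e` has the same value as `e`, this shows that
`e w' e` can replace `e` in the words of `L`, and likewise in those of its complement. Hence
`{w | e φ(w) e = e}` is a union of finite intersections of quotients of languages of `C`.

*Decidability.* An automaton bounds the size of the syntactic monoid, so that words of bounded
length represent all its elements, and automata for the finitely many languages of the criterion can
be computed and passed to the algorithm for `C`.
-/

open FreeMonoid
open scoped Computability

section KleeneAlgebra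

variable {α : Type*} [KleeneAlgebra α] (a b : α)

theorem kstar_eq_one_add_add_mul_kstar_mul :
    a∗ = 1 + a + a * a∗ * a := by
  nth_rw 1 [← one_add_mul_kstar, ← one_add_kstar_mul]
  rw [mul_add, mul_one, add_assoc, mul_assoc]

theorem add_kstar_le : (a + b)∗ ≤ a∗ * (b * a∗)∗ := by
  have one_le : (1 : α) ≤ (b * a∗)∗ := one_le_kstar
  have a_mul_le : a * (a∗ * (b * a∗)∗) ≤ a∗ * (b * a∗)∗ := by
    rw [← mul_assoc]
    gcongr
    exact mul_kstar_le_kstar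
  have b_mul_le : b * (a∗ * (b * a∗)∗) ≤ a∗ * (b * a∗)∗ :=
    calc b * (a∗ * (b * a∗)∗) = b * a∗ * (b * a∗)∗ := (mul_assoc ..).symm
      _ ≤ (b * a∗)∗ := mul_kstar_le_kstar
      _ = 1 * (b * a∗)∗ := (one_mul _).symm
      _ ≤ a∗ * (b * a∗)∗ := by gcongr; exact one_le_kstar
  refine kstar_le_of_mul_le_right (one_le_mul one_le_kstar one_le) ?_
  rw [add_mul]
  exact add_le a_mul_le b_mul_le

theorem kstar_le_one_add_mul_kstar_mul_self : a∗ ≤ (1 + a) * (a * a)∗ := by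
  refine kstar_le_of_mul_le_right ?_ ?_
  · exact one_le_mul le_self_add one_le_kstar
  · calc a * ((1 + a) * (a * a)∗) = a * (a * a)∗ + a * a * (a * a)∗ := by
          simp only [mul_add, add_mul, one_mul, mul_assoc]
      _ ≤ a * (a * a)∗ + (a * a)∗ := by gcongr; exact mul_kstar_le_kstar
      _ = (1 + a) * (a * a)∗ := by rw [add_mul, one_mul, add_comm]

end KleeneAlgebra

section FiniteMonoid

variable {A M : Type*} [Monoid M] [Finite M]

theorem exists_ne_zero_isIdempotentElem_pow (a : M) :
    ∃ n ≠ 0, IsIdempotentElem (a ^ n) := by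
  let _ : TopologicalSpace M := ⊥
  have : DiscreteTopology M := ⟨rfl⟩
  obtain ⟨_, ⟨n, rfl⟩, hn⟩ := exists_idempotent_in_compact_subsemigroup
    (fun _ => continuous_of_discreteTopology) (Set.range fun n => a ^ (n + 1))
    (Set.range_nonempty _) (Set.toFinite _).isCompact (by
      rintro _ ⟨i, rfl⟩ _ ⟨j, rfl⟩
      exact ⟨i + 1 + j, by rw [← pow_add]; rfl⟩)
  exact ⟨n + 1, n.succ_ne_zero, hn⟩

theorem exists_length_lt_card_map_eq (φ : FreeMonoid A →* M) (w : FreeMonoid A) :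
    ∃ v, v.length < Nat.card M ∧ φ v = φ w := by
  obtain ⟨v, hv, hmin⟩ :=
    exists_minimalFor_of_wellFoundedLT (fun v => φ v = φ w) FreeMonoid.length ⟨w, rfl⟩
  refine ⟨v, lt_of_not_ge fun hcard => ?_, hv⟩
  let value (i : Fin (v.length + 1)) : M := φ (ofList ((toList v).take i))
  have hninj : ¬ Function.Injective value := fun hinj => by
    have := Nat.card_le_card_of_injective value hinj
    rw [Nat.card_fin] at this
    omega
  obtain ⟨i, j, hij, hne⟩ := Function.not_injective_iff.1 hninj
  wlog hlt : i < j generalizing i j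
  · exact this j i hij.symm hne.symm (hne.lt_or_gt.resolve_left hlt)
  let shortcut : FreeMonoid A := ofList ((toList v).take i) * ofList ((toList v).drop j)
  have hshortcut : φ shortcut = φ w := by
    have hsplit : ofList ((toList v).take j) * ofList ((toList v).drop j) = v :=
      List.take_append_drop j (toList v)
    rw [map_mul, show φ (ofList ((toList v).take i)) = _ from hij, ← map_mul, hsplit, hv]
  have hlength : shortcut.length < v.length := by
    simp only [shortcut, FreeMonoid.length, toList_mul, toList_ofList, List.length_append,
      List.length_take, List.length_drop]
    have hj : (j : ℕ) ≤ (toList v).length := Nat.lt_succ_iff.1 j.isLt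
    omega
  exact hlength.not_ge (hmin hshortcut hlength.le)

end FiniteMonoid

section Factorization

variable {A M : Type*} [Monoid M] {φ : FreeMonoid A →* M} {𝓗 : Set (Language A)}
  {H K X : Language A} {P : Set M} {S : Subsemigroup M} {g q : M}

/-- The language of the words with value `m` under the morphism `φ`. -/
def fiber (φ : FreeMonoid A →* M) (m : M) : Language A := {w | φ (ofList w) = m}

theorem mem_fiber {m : M} {w : List A} : w ∈ fiber φ m ↔ φ (ofList w) = m := Iff.rfl

theorem one_le_fiber_one : 1 ≤ fiber φ 1 := by
  rintro w rfl
  exact map_one φ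

theorem fiber_mul_fiber_le (m n : M) : fiber φ m * fiber φ n ≤ fiber φ (m * n) := by
  rintro _ ⟨u, rfl, v, rfl, rfl⟩
  exact map_mul φ (ofList u) (ofList v)

/-- A class of languages with the closure properties that force it to contain every language
once it contains the singletons: it is an ideal for union and closed under product and under the
star of languages all of whose words have the same idempotent value under `φ`. -/
structure IsFactorizationClass (φ : FreeMonoid A →* M) (𝓗 : Set (Language A)) : Prop where
  isLowerSet : IsLowerSet 𝓗
  add_mem : ∀ {H K}, H ∈ 𝓗 → K ∈ 𝓗 → H + K ∈ 𝓗
  one_mem : 1 ∈ 𝓗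
  mul_mem : ∀ {H K}, H ∈ 𝓗 → K ∈ 𝓗 → H * K ∈ 𝓗
  kstar_mem_of_le_fiber : ∀ {H e}, IsIdempotentElem e → H ∈ 𝓗 → H ≤ fiber φ e → H∗ ∈ 𝓗

/-- The words obtained by appending words of `X` one after the other, in such a way that the value
of the word, multiplied by `g` on the left, lies in `P` after each step. They label the walks from
`g` through `P` in the right Cayley graph of `M`. -/
inductive IsWalk (φ : FreeMonoid A →* M) (X : Language A) (P : Set M) (g : M) : List A → Prop
  | nil : IsWalk φ X P g []
  | append {w x : List A} : IsWalk φ X P g w → x ∈ X →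
      g * φ (ofList w) * φ (ofList x) ∈ P → IsWalk φ X P g (w ++ x)

/-- The language of the labels of the walks from `g` through `P`. -/
def walks (φ : FreeMonoid A →* M) (X : Language A) (P : Set M) (g : M) : Language A :=
  {w | IsWalk φ X P g w}

/-- The words that label a walk from `g` through `P` followed by one more step, ending at `q`. -/
def arrivals (φ : FreeMonoid A →* M) (X : Language A) (P : Set M) (g q : M) : Language A :=
  walks φ X P g * X ⊓ {w | g * φ (ofList w) = q}

theorem append_mem_walks {w x : List A} (hw : w ∈ walks φ X P g) (hx : x ∈ X)
    (h : g * φ (ofList (w ++ x)) ∈ P) : w ++ x ∈ walks φ X P g :=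
  IsWalk.append hw hx (by rwa [ofList_append, map_mul, ← mul_assoc] at h)

theorem append_mem_arrivals {w x : List A} (hw : w ∈ walks φ X P g) (hx : x ∈ X)
    (h : g * φ (ofList (w ++ x)) = q) : w ++ x ∈ arrivals φ X P g q :=
  ⟨Language.append_mem_mul hw hx, h⟩

theorem mul_value_mem_of_mem_walks {w : List A} (hw : w ∈ walks φ X P g) (hg : g ∈ P) :
    g * φ (ofList w) ∈ P := by
  cases hw with
  | nil => simpa using hg
  | append _ _ h => rwa [ofList_append, map_mul, ← mul_assoc]

theorem walks_empty_le : walks φ X ∅ g ≤ 1 := by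
  rintro _ (_ | ⟨_, _, h⟩)
  · rfl
  · exact h.elim

theorem walks_le_kstar : walks φ X P g ≤ X∗ := by
  intro w (hw : IsWalk φ X P g w)
  induction hw with
  | nil => exact Language.nil_mem_kstar X
  | append _ hx _ ih => exact kstar_mul_le_kstar (a := X) (Language.append_mem_mul ih hx)

theorem mul_value_eq_of_mem_kstar {w : List A} (hH : ∀ w ∈ H, q * φ (ofList w) = q)
    (hw : w ∈ H∗) : q * φ (ofList w) = q := by
  suffices H∗ ≤ ({w | q * φ (ofList w) = q} : Language A) from this hw
  refine kstar_le_of_mul_le_left ?_ ?_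
  · rintro _ rfl
    simp
  · rintro _ ⟨u, hu : _ = q, v, hv, rfl⟩
    change q * φ (ofList (u ++ v)) = q
    rw [ofList_append, map_mul, ← mul_assoc, hu, hH v hv]

theorem walks_insert_le : walks φ X (insert q P) g ≤ walks φ X P g +
    arrivals φ X P g q * (arrivals φ X P q q)∗ * walks φ X P q := by
  intro w (hw : IsWalk φ X (insert q P) g w)
  induction hw with
  | nil => exact Or.inl .nil
  | @append w x _ hx hwx ih =>
    rw [mul_assoc, ← map_mul, ← ofList_append] at hwx
    obtain hw | ⟨_, ⟨f, hf, l, hl, rfl⟩, v, hv, rfl⟩ := ih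
    · obtain hq | hP := hwx
      · exact Or.inr ⟨_, ⟨_, append_mem_arrivals hw hx hq, [], Language.nil_mem_kstar _, rfl⟩,
          [], .nil, by simp⟩
      · exact Or.inl (append_mem_walks hw hx hP)
    · have hval : g * φ (ofList (f ++ l ++ v ++ x)) = q * φ (ofList (v ++ x)) := by
        have hf' : g * φ (ofList f) = q := hf.2
        have hl' : q * φ (ofList l) = q := mul_value_eq_of_mem_kstar (fun _ h => h.2) hl
        simp only [ofList_append, map_mul, ← mul_assoc, hf', hl']
      rw [hval] at hwx
      obtain hq | hP := hwx
      · exact Or.inr ⟨_, ⟨f, hf, _, kstar_mul_le_kstar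
          (a := arrivals φ X P q q) (Language.append_mem_mul hl (append_mem_arrivals hv hx hq)),
          rfl⟩, [], .nil, by simp⟩
      · exact Or.inr ⟨_, ⟨f, hf, l, hl, rfl⟩, _, append_mem_walks hv hx hP, by simp⟩

theorem value_mul_mem_and_mul_value_mem {w : List A} {s : M}
    (hX : ∀ x ∈ X, φ (ofList x) ∈ S) (hw : w ∈ X∗) (hs : s ∈ S) :
    φ (ofList w) * s ∈ S ∧ s * φ (ofList w) ∈ S := by
  suffices X∗ ≤ ({w | ∀ s ∈ S, φ (ofList w) * s ∈ S ∧ s * φ (ofList w) ∈ S} : Language A) from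
    this hw s hs
  refine kstar_le_of_mul_le_left ?_ ?_
  · rintro _ rfl s hs
    simp [hs]
  · rintro _ ⟨u, hu, x, hx, rfl⟩ s hs
    change φ (ofList (u ++ x)) * s ∈ S ∧ s * φ (ofList (u ++ x)) ∈ S
    rw [ofList_append, map_mul, mul_assoc (φ _), ← mul_assoc s]
    exact ⟨(hu _ (S.mul_mem (hX x hx) hs)).1, S.mul_mem (hu s hs).2 (hX x hx)⟩

theorem value_mem_of_mem_arrivals {w : List A} (hX : ∀ x ∈ X, φ (ofList x) ∈ S)
    (hw : w ∈ arrivals φ X P g q) : φ (ofList w) ∈ S := by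
  obtain ⟨⟨u, hu, x, hx, rfl⟩, -⟩ := hw
  change φ (ofList (u ++ x)) ∈ S
  rw [ofList_append, map_mul]
  exact (value_mul_mem_and_mul_value_mem hX (walks_le_kstar hu) (hX x hx)).1

/-- The left translate `m S` of a subsemigroup `S` by one of its elements `m`. -/
def mulLeftSubsemigroup (S : Subsemigroup M) (m : M) (hm : m ∈ S) : Subsemigroup M where
  carrier := (m * ·) '' S
  mul_mem' := by
    rintro _ _ ⟨s, hs, rfl⟩ ⟨t, ht, rfl⟩
    exact ⟨s * (m * t), S.mul_mem hs (S.mul_mem hm ht), by simp only [mul_assoc]⟩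

theorem ncard_mulLeftSubsemigroup_lt [Finite M] {m : M} (hm : m ∈ S)
    (hinj : ¬ Set.InjOn (m * ·) S) :
    (mulLeftSubsemigroup S m hm : Set M).ncard < (S : Set M).ncard :=
  (Set.ncard_image_le (Set.toFinite _)).lt_of_ne fun h => hinj (Set.injOn_of_ncard_image_eq h)

theorem value_mem_mulLeftSubsemigroup {m : M} (hm : m ∈ S) (hX : ∀ x ∈ X, φ (ofList x) ∈ S)
    {w : List A} (hw : w ∈ fiber φ m * X∗ * (fiber φ m * X∗)) :
    φ (ofList w) ∈ mulLeftSubsemigroup S m hm := by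
  obtain ⟨_, ⟨b, hb, y, hy, rfl⟩, _, ⟨c, hc, z, hz, rfl⟩, rfl⟩ := hw
  have hym := (value_mul_mem_and_mul_value_mem hX hy hm).1
  refine ⟨φ (ofList y) * m * φ (ofList z), (value_mul_mem_and_mul_value_mem hX hz hym).2, ?_⟩
  change m * _ = φ (ofList (b ++ y ++ (c ++ z)))
  simp only [ofList_append, map_mul, mem_fiber.1 hb, mem_fiber.1 hc, mul_assoc]

namespace IsFactorizationClass

/-- If `q` is fixed by the values of `H` and can be cancelled, then these values are all equal to
one idempotent. -/
theorem kstar_mem_of_mul_value_eq (h𝓗 : IsFactorizationClass φ 𝓗) (hH : H ∈ 𝓗)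
    (hHS : ∀ w ∈ H, φ (ofList w) ∈ S) (hq : Set.InjOn (q * ·) S)
    (hHq : ∀ w ∈ H, q * φ (ofList w) = q) : H∗ ∈ 𝓗 := by
  by_cases hne : ∃ u, u ∈ H
  · obtain ⟨u, hu⟩ := hne
    refine h𝓗.kstar_mem_of_le_fiber (e := φ (ofList u)) (hq ?_ ?_ ?_) hH fun w hw => ?_
    · exact S.mul_mem (hHS u hu) (hHS u hu)
    · exact hHS u hu
    · simp only [← mul_assoc, hHq u hu]
    · exact hq (hHS w hw) (hHS u hu) ((hHq w hw).trans (hHq u hu).symm)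
  · refine h𝓗.kstar_mem_of_le_fiber (e := 1) (.one) hH fun w hw => (hne ⟨w, hw⟩).elim

theorem walks_mem (h𝓗 : IsFactorizationClass φ 𝓗) (hX : X ∈ 𝓗)
    (hXS : ∀ x ∈ X, φ (ofList x) ∈ S) (hPfin : P.Finite) (hP : ∀ q ∈ P, Set.InjOn (q * ·) S) :
    ∀ g, walks φ X P g ∈ 𝓗 := by
  induction P, hPfin using Set.Finite.induction_on with
  | empty => exact fun g => h𝓗.isLowerSet walks_empty_le h𝓗.one_mem
  | @insert q P _ _ ih =>
    have hwalks := ih fun p hp => hP p (Set.mem_insert_of_mem q hp)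
    have harrivals (g : M) : arrivals φ X P g q ∈ 𝓗 :=
      h𝓗.isLowerSet inf_le_left (h𝓗.mul_mem (hwalks g) hX)
    have hloops : (arrivals φ X P q q)∗ ∈ 𝓗 :=
      h𝓗.kstar_mem_of_mul_value_eq (harrivals q) (fun w => value_mem_of_mem_arrivals hXS)
        (hP q (Set.mem_insert q P)) fun w hw => hw.2
    exact fun g => h𝓗.isLowerSet walks_insert_le (h𝓗.add_mem (hwalks g)
      (h𝓗.mul_mem (h𝓗.mul_mem (harrivals g) hloops) (hwalks q)))

theorem kstar_mem_of_injOn [Finite M] (h𝓗 : IsFactorizationClass φ 𝓗) (hX : X ∈ 𝓗)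
    (hXS : ∀ x ∈ X, φ (ofList x) ∈ S) (hinj : ∀ x ∈ X, Set.InjOn (φ (ofList x) * ·) S) :
    X∗ ∈ 𝓗 := by
  let T : Set M := {q | Set.InjOn (q * ·) S}
  have one_mem : (1 : M) ∈ T := by simp [T, Set.InjOn]
  have mul_mem {q : M} (hq : q ∈ T) {x : List A} (hx : x ∈ X) : q * φ (ofList x) ∈ T := by
    intro s hs t ht hst
    simp only [mul_assoc] at hst
    exact hinj x hx hs ht (hq (S.mul_mem (hXS x hx) hs) (S.mul_mem (hXS x hx) ht) hst)
  suffices X∗ ≤ walks φ X T 1 from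
    h𝓗.isLowerSet this (h𝓗.walks_mem hX hXS T.toFinite (fun q hq => hq) 1)
  refine kstar_le_of_mul_le_left ?_ ?_
  · rintro _ rfl
    exact .nil
  · rintro _ ⟨w, hw, x, hx, rfl⟩
    exact .append hw hx (mul_mem (mul_value_mem_of_mem_walks hw one_mem) hx)

/-- Simon's factorization argument, by induction on `S` and on the set of values of `X`: if a value
`m` of `X` is not cancellable in `S`, the words of `X` with value `m` are separated from the others,
and a product of two blocks, each starting with such a word, has its value in `m S`. -/
theorem kstar_mem_of_value_mem [Finite M] (h𝓗 : IsFactorizationClass φ 𝓗)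
    {S : Subsemigroup M} {X : Language A} (hX : X ∈ 𝓗) (hXS : ∀ x ∈ X, φ (ofList x) ∈ S) :
    X∗ ∈ 𝓗 := by
  by_cases hinj : ∀ x ∈ X, Set.InjOn (φ (ofList x) * ·) S
  · exact h𝓗.kstar_mem_of_injOn hX hXS hinj
  push Not at hinj
  obtain ⟨x, hx, hx_inj⟩ := hinj
  let m := φ (ofList x)
  let B : Language A := X ⊓ fiber φ m
  let Y : Language A := X ⊓ (fiber φ m)ᶜ
  let Z := B * Y∗
  have hXYB : X ≤ Y + B := fun w hw => (em (w ∈ fiber φ m)).elim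
    (fun h => Or.inr ⟨hw, h⟩) (fun h => Or.inl ⟨hw, h⟩)
  have hYS (y : List A) (hy : y ∈ Y) : φ (ofList y) ∈ S := hXS y hy.1
  have hYstar : Y∗ ∈ 𝓗 := h𝓗.kstar_mem_of_value_mem (h𝓗.isLowerSet inf_le_left hX) hYS
  have hZ : Z ∈ 𝓗 := h𝓗.mul_mem (h𝓗.isLowerSet inf_le_left hX) hYstar
  have hZle : Z ≤ fiber φ m * Y∗ := mul_le_mul_left inf_le_right _
  have hZZ : (Z * Z)∗ ∈ 𝓗 := h𝓗.kstar_mem_of_value_mem (h𝓗.mul_mem hZ hZ) fun w hw =>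
    value_mem_mulLeftSubsemigroup (hXS x hx) hYS (mul_le_mul' hZle hZle hw)
  refine h𝓗.isLowerSet ?_ (h𝓗.mul_mem hYstar (h𝓗.mul_mem (h𝓗.add_mem h𝓗.one_mem hZ) hZZ))
  calc X∗ ≤ (Y + B)∗ := kstar_mono hXYB
    _ ≤ Y∗ * Z∗ := add_kstar_le Y B
    _ ≤ Y∗ * ((1 + Z) * (Z * Z)∗) := by gcongr; exact kstar_le_one_add_mul_kstar_mul_self Z
termination_by ((S : Set M).ncard, ((fun x => φ (ofList x)) '' X).ncard)
decreasing_by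
  · refine Prod.Lex.right _ (Set.ncard_lt_ncard ⟨?_, ?_⟩)
    · rintro _ ⟨w, hw, rfl⟩
      exact ⟨w, hw.1, rfl⟩
    · intro h
      obtain ⟨w, hw, hwm⟩ := h ⟨x, hx, rfl⟩
      exact hw.2 hwm
  · exact Prod.Lex.left _ _ (ncard_mulLeftSubsemigroup_lt (hXS x hx) hx_inj)

theorem mem_of_singleton_mem [Finite A] [Finite M] (h𝓗 : IsFactorizationClass φ 𝓗)
    (hsingleton : ∀ a : A, ({[a]} : Language A) ∈ 𝓗) (L : Language A) : L ∈ 𝓗 := by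
  let letters : Language A := ⨆ a : A, {[a]}
  have letters_mem : letters ∈ 𝓗 :=
    SupClosed.iSup_mem (fun _ hH _ hK => h𝓗.add_mem hH hK)
      (h𝓗.isLowerSet bot_le h𝓗.one_mem) hsingleton
  refine h𝓗.isLowerSet (fun w _ => ?_) (h𝓗.kstar_mem_of_value_mem (S := ⊤) letters_mem
    fun _ _ => Subsemigroup.mem_top _)
  refine Language.mem_kstar.2 ⟨w.map ([·]), by simp [← List.flatMap_def], ?_⟩
  simp only [List.mem_map, forall_exists_index, and_imp, forall_apply_eq_imp_iff₂]
  exact fun a _ => Language.mem_iSup.2 ⟨a, rfl⟩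

end IsFactorizationClass

end Factorization

section PolynomialClosure

variable {A M : Type*} [Monoid M] {φ : FreeMonoid A →* M} {C : Set (Language A)}
  {H K L : Language A} {e m : M}

theorem eq_inf_one_add_iSup_singleton_mul_leftQuotient (L : Language A) :
    L = L ⊓ 1 + ⨆ a : A, ({[a]} : Language A) * L.leftQuotient [a] := by
  ext w
  rw [Language.mem_add, Language.mem_inf, Language.mem_one, Language.mem_iSup]
  have mem_singleton (u v : List A) : u ∈ ({v} : Language A) ↔ u = v := Iff.rfl
  cases w <;> simp [Language.mem_mul, Language.mem_leftQuotient, mem_singleton]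

namespace InPol

theorem supClosed : SupClosed {L : Language A | InPol C L} :=
  fun K hK L hL => .union K L hK hL

theorem mul [Finite A] (hbot : ⊥ ∈ C) (hquot : ∀ L ∈ C, ∀ a, L.leftQuotient [a] ∈ C)
    (hK : InPol C K) (hL : InPol C L) : InPol C (K * L) := by
  induction hL with
  | base L hL =>
    have hmul_one : InPol C (K * (L ⊓ 1)) := by
      by_cases hnil : [] ∈ L
      · have : L ⊓ 1 = 1 := inf_eq_right.2 (by rintro _ rfl; exact hnil)
        rwa [this, mul_one]
      · have : L ⊓ 1 = 0 := le_bot_iff.1 (by rintro _ ⟨h, rfl⟩; exact hnil h)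
        rw [this, mul_zero]
        exact .base ⊥ hbot
    rw [eq_inf_one_add_iSup_singleton_mul_leftQuotient L, mul_add, Language.mul_iSup]
    refine .union _ _ hmul_one (supClosed.iSup_mem (.base ⊥ hbot) fun a => ?_)
    rw [← mul_assoc]
    exact .markedConcat K _ a hK (.base _ (hquot L hL a))
  | union L₁ L₂ _ _ h₁ h₂ => exact mul_add K L₁ L₂ ▸ .union _ _ h₁ h₂
  | markedConcat L₁ L₂ a _ h₂ h₁ _ =>
    rw [← mul_assoc, ← mul_assoc]
    exact .markedConcat _ _ a h₁ h₂

end InPol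

/-- For each `m`, the words of `H` with value `m` under `φ` are covered by a language of `Pol(C)`
all of whose words have value `m`. -/
def PolCoverable (C : Set (Language A)) (φ : FreeMonoid A →* M) (H : Language A) : Prop :=
  ∀ m, ∃ Z, InPol C Z ∧ H ⊓ fiber φ m ≤ Z ∧ Z ≤ fiber φ m

/-- The words whose value `m` under `φ` satisfies `e m e = e`. -/
def localStabilizer (φ : FreeMonoid A →* M) (e : M) : Language A :=
  {w | e * φ (ofList w) * e = e}

theorem localStabilizer_one : localStabilizer φ 1 = fiber φ 1 := by
  ext w
  change 1 * φ (ofList w) * 1 = 1 ↔ φ (ofList w) = 1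
  rw [one_mul, mul_one]

namespace PolCoverable

theorem mono (hK : PolCoverable C φ K) (hHK : H ≤ K) : PolCoverable C φ H := fun m =>
  let ⟨Z, hZ, hKZ, hZm⟩ := hK m
  ⟨Z, hZ, (inf_le_inf_right _ hHK).trans hKZ, hZm⟩

theorem add (hH : PolCoverable C φ H) (hK : PolCoverable C φ K) : PolCoverable C φ (H + K) := by
  intro m
  obtain ⟨Y, hY, hHY, hYm⟩ := hH m
  obtain ⟨Z, hZ, hKZ, hZm⟩ := hK m
  refine ⟨Y + Z, .union Y Z hY hZ, ?_, sup_le hYm hZm⟩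
  exact (inf_sup_right ..).trans_le (sup_le_sup hHY hKZ)

theorem supClosed : SupClosed {H | PolCoverable C φ H} := fun _ hH _ hK => add hH hK

theorem of_le_fiber (hbot : ⊥ ∈ C) (hH : InPol C H) (hm : H ≤ fiber φ m) :
    PolCoverable C φ H := by
  intro n
  by_cases hmn : m = n
  · exact ⟨H, hH, inf_le_left, hmn ▸ hm⟩
  · exact ⟨⊥, .base ⊥ hbot, fun w ⟨hw, hwn⟩ => hmn ((hm hw).symm.trans hwn), bot_le⟩

theorem exists_inPol_le_fiber (hH : PolCoverable C φ H) (hm : H ≤ fiber φ m) :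
    ∃ Z, InPol C Z ∧ H ≤ Z ∧ Z ≤ fiber φ m :=
  let ⟨Z, hZ, hHZ, hZm⟩ := hH m
  ⟨Z, hZ, (le_inf le_rfl hm).trans hHZ, hZm⟩

theorem fiber_one (hbot : ⊥ ∈ C)
    (hstab : ∀ e, IsIdempotentElem e → localStabilizer φ e ∈ C) : PolCoverable C φ (fiber φ 1) :=
  of_le_fiber hbot (.base _ (localStabilizer_one (φ := φ) ▸ hstab 1 .one)) le_rfl

theorem singleton (hbot : ⊥ ∈ C)
    (hstab : ∀ e, IsIdempotentElem e → localStabilizer φ e ∈ C) (a : A) :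
    PolCoverable C φ {[a]} := by
  have hone : InPol C (fiber φ 1) := .base _ (localStabilizer_one (φ := φ) ▸ hstab 1 .one)
  have hle : {[a]} ≤ fiber φ (φ (of a)) := by
    rintro _ rfl
    rfl
  have hcover : PolCoverable C φ (fiber φ 1 * {[a]} * fiber φ 1) := by
    refine of_le_fiber hbot (.markedConcat _ _ a hone hone) (m := φ (of a)) ?_
    calc fiber φ 1 * {[a]} * fiber φ 1 ≤ fiber φ 1 * fiber φ (φ (of a)) * fiber φ 1 := by gcongr
      _ ≤ fiber φ (1 * φ (of a) * 1) :=
          (mul_le_mul_left (fiber_mul_fiber_le ..) _).trans (fiber_mul_fiber_le ..)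
      _ = fiber φ (φ (of a)) := by rw [one_mul, mul_one]
  refine hcover.mono ?_
  calc ({[a]} : Language A) = 1 * {[a]} * 1 := by rw [one_mul, mul_one]
    _ ≤ fiber φ 1 * {[a]} * fiber φ 1 := by gcongr <;> exact one_le_fiber_one

theorem mul [Finite A] [Finite M] (hbot : ⊥ ∈ C) (hquot : ∀ L ∈ C, ∀ a, L.leftQuotient [a] ∈ C)
    (hH : PolCoverable C φ H) (hK : PolCoverable C φ K) : PolCoverable C φ (H * K) := by
  choose Y hY hHY hYm using hH
  choose Z hZ hKZ hZm using hK
  have hiSup : PolCoverable C φ (⨆ p : M × M, Y p.1 * Z p.2) :=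
    supClosed.iSup_mem ((of_le_fiber hbot (hY 1) (hYm 1)).mono bot_le)
      fun (p : M × M) => of_le_fiber hbot ((hY p.1).mul hbot hquot (hZ p.2))
        ((mul_le_mul' (hYm p.1) (hZm p.2)).trans (fiber_mul_fiber_le p.1 p.2))
  refine hiSup.mono ?_
  rintro _ ⟨u, hu, v, hv, rfl⟩
  exact Language.mem_iSup.2 ⟨(φ (ofList u), φ (ofList v)),
    Language.append_mem_mul (hHY _ ⟨hu, rfl⟩) (hKZ _ ⟨hv, rfl⟩)⟩

end PolCoverable

theorem mul_localStabilizer_mul_le : fiber φ e * localStabilizer φ e * fiber φ e ≤ fiber φ e := by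
  rintro _ ⟨_, ⟨u, hu, v, hv, rfl⟩, w, hw, rfl⟩
  change φ (ofList (u ++ v ++ w)) = e
  rw [ofList_append, ofList_append, map_mul, map_mul, mem_fiber.1 hu, mem_fiber.1 hw]
  exact hv

theorem kstar_le_localStabilizer (he : IsIdempotentElem e) (hH : H ≤ fiber φ e) :
    H∗ ≤ localStabilizer φ e := by
  refine kstar_le_of_mul_le_left ?_ ?_
  · rintro _ rfl
    change e * φ 1 * e = e
    rw [map_one, mul_one, he.eq]
  · rintro _ ⟨u, hu : _ = e, v, hv, rfl⟩
    change e * φ (ofList (u ++ v)) * e = e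
    rw [ofList_append, map_mul, mem_fiber.1 (hH hv), mul_assoc, mul_assoc, he.eq, ← mul_assoc, hu]

theorem isFactorizationClass_polCoverable [Finite A] [Finite M] (hbot : ⊥ ∈ C)
    (hquot : ∀ L ∈ C, ∀ a, L.leftQuotient [a] ∈ C)
    (hstab : ∀ e, IsIdempotentElem e → localStabilizer φ e ∈ C) :
    IsFactorizationClass φ {H | PolCoverable C φ H} where
  isLowerSet _ _ hHK hH := hH.mono hHK
  add_mem := PolCoverable.add
  one_mem := (PolCoverable.fiber_one hbot hstab).mono one_le_fiber_one
  mul_mem := PolCoverable.mul hbot hquot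
  kstar_mem_of_le_fiber {H e} he hH hHe := by
    obtain ⟨Z, hZ, hHZ, hZe⟩ := hH.exists_inPol_le_fiber hHe
    let U := localStabilizer φ e
    have hZUZ : InPol C (Z * U * Z) :=
      (hZ.mul hbot hquot (.base U (hstab e he))).mul hbot hquot hZ
    have hZUZe : Z * U * Z ≤ fiber φ e :=
      calc Z * U * Z ≤ fiber φ e * U * fiber φ e := by gcongr
        _ ≤ fiber φ e := mul_localStabilizer_mul_le
    have hcover : PolCoverable C φ (fiber φ 1 + (Z + Z * U * Z)) :=
      .add (.fiber_one hbot hstab)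
        (.of_le_fiber hbot (.union _ _ hZ hZUZ) (sup_le hZe hZUZe))
    refine hcover.mono ?_
    calc H∗ = 1 + (H + H * H∗ * H) := by
          rw [← add_assoc, ← kstar_eq_one_add_add_mul_kstar_mul]
      _ ≤ fiber φ 1 + (Z + Z * U * Z) := by
          have := kstar_le_localStabilizer he hHe
          gcongr
          exact one_le_fiber_one

theorem polCoverable_of_localStabilizer_mem [Finite A] [Finite M] (hbot : ⊥ ∈ C)
    (hquot : ∀ L ∈ C, ∀ a, L.leftQuotient [a] ∈ C)
    (hstab : ∀ e, IsIdempotentElem e → localStabilizer φ e ∈ C) (H : Language A) :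
    PolCoverable C φ H :=
  (isFactorizationClass_polCoverable hbot hquot hstab).mem_of_singleton_mem
    (fun a => .singleton hbot hstab a) H

/-- `φ` recognizes `L`: membership in `L` only depends on the value under `φ`. -/
def Recognizes (φ : FreeMonoid A →* M) (L : Language A) : Prop :=
  ∀ u v, φ u = φ v → (toList u ∈ L ↔ toList v ∈ L)

theorem Recognizes.compl (h : Recognizes φ L) : Recognizes φ Lᶜ :=
  fun u v huv => not_congr (h u v huv)

theorem InPol.of_localStabilizer_mem [Finite A] [Finite M] (hbot : ⊥ ∈ C)
    (hquot : ∀ L ∈ C, ∀ a, L.leftQuotient [a] ∈ C)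
    (hstab : ∀ e, IsIdempotentElem e → localStabilizer φ e ∈ C) (hL : Recognizes φ L) :
    InPol C L := by
  choose Z hZ hLZ hZm using polCoverable_of_localStabilizer_mem hbot hquot hstab L
  have hL_eq : L = ⨆ m : {m // ∃ w ∈ L, φ (ofList w) = m}, Z m := by
    ext w
    rw [Language.mem_iSup]
    constructor
    · exact fun hw => ⟨⟨_, w, hw, rfl⟩, hLZ _ ⟨hw, rfl⟩⟩
    · rintro ⟨⟨m, v, hv, hvm⟩, hw⟩
      exact (hL (ofList v) (ofList w) (hvm.trans (hZm m hw).symm)).1 hv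
  rw [hL_eq]
  exact supClosed.iSup_mem (.base ⊥ hbot) fun m => hZ m

end PolynomialClosure

section SyntacticMonoid

variable {A σ : Type*} {L : Language A}

/-- The syntactic congruence of `L`: two words are congruent if they can be exchanged in every
context without affecting membership in `L`. Its quotient is the syntactic monoid of `L`. -/
def syntacticCon (L : Language A) : Con (FreeMonoid A) where
  r u v := ∀ x y, toList (x * u * y) ∈ L ↔ toList (x * v * y) ∈ L
  iseqv := ⟨fun _ _ _ => Iff.rfl, fun h x y => (h x y).symm,
    fun h h' x y => (h x y).trans (h' x y)⟩
  mul' {u u' v v'} h h' x y := by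
    have hu := h x (v * y)
    have hv := h' (x * u') y
    simp only [mul_assoc] at hu hv ⊢
    exact hu.trans hv

theorem syntacticCon_mk'_eq {u v : FreeMonoid A} :
    (syntacticCon L).mk' u = (syntacticCon L).mk' v ↔ syntacticCon L u v :=
  (syntacticCon L).eq

theorem recognizes_mk'_syntacticCon (L : Language A) : Recognizes (syntacticCon L).mk' L :=
  fun u v huv => by simpa using syntacticCon_mk'_eq.1 huv 1 1

theorem evalFrom_subset {M : NFA A σ} {Q S : Set σ} (hstep : ∀ p a, M.step p a ⊆ Q)
    (hS : S ⊆ Q) (w : List A) : M.evalFrom S w ⊆ Q := by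
  induction w generalizing S with
  | nil => exact hS
  | cons a _ ih => exact ih (Set.iUnion₂_subset fun p _ => hstep p a)

/-- The pairs of states in `Q` joined by a path labelled `w`. -/
def transitionRel (M : NFA A σ) (Q : Set σ) (w : List A) : Set (Q × Q) :=
  {pq | pq.2.1 ∈ M.evalFrom {pq.1.1} w}

theorem evalFrom_eq_of_transitionRel_eq {M : NFA A σ} {Q S : Set σ} {u v : List A}
    (hstep : ∀ p a, M.step p a ⊆ Q) (hS : S ⊆ Q)
    (huv : transitionRel M Q u = transitionRel M Q v) : M.evalFrom S u = M.evalFrom S v := by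
  ext q
  by_cases hq : q ∈ Q
  · rw [NFA.mem_evalFrom_iff_exists, NFA.mem_evalFrom_iff_exists]
    exact exists_congr fun p => and_congr_right fun hp =>
      Set.ext_iff.1 huv (⟨p, hS hp⟩, ⟨q, hq⟩)
  · exact iff_of_false (fun h => hq (evalFrom_subset hstep hS u h))
      (fun h => hq (evalFrom_subset hstep hS v h))

theorem syntacticCon_of_transitionRel_eq {M : NFA A σ} {Q : Set σ} {u v : FreeMonoid A}
    (hstart : M.start ⊆ Q) (hstep : ∀ p a, M.step p a ⊆ Q)
    (huv : transitionRel M Q (toList u) = transitionRel M Q (toList v)) :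
    syntacticCon M.accepts u v := by
  intro x y
  have heval := evalFrom_eq_of_transitionRel_eq hstep
    (evalFrom_subset hstep hstart (toList x)) huv
  simp only [NFA.mem_accepts, toList_mul, NFA.evalFrom_append, heval]

theorem injective_transitionRel_out {M : NFA A σ} {Q : Set σ} (hstart : M.start ⊆ Q)
    (hstep : ∀ p a, M.step p a ⊆ Q) : Function.Injective
      fun m : (syntacticCon M.accepts).Quotient => transitionRel M Q (toList (Quotient.out m)) :=
  fun m n hmn => by
    have := syntacticCon_of_transitionRel_eq hstart hstep hmn
    rw [← Quotient.out_eq m, ← Quotient.out_eq n]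
    exact Quotient.sound this

theorem card_quotient_syntacticCon_accepts_le {M : NFA A σ} {Q : Set σ} [Finite Q]
    (hstart : M.start ⊆ Q) (hstep : ∀ p a, M.step p a ⊆ Q) :
    Nat.card (syntacticCon M.accepts).Quotient ≤ 2 ^ (Q.ncard * Q.ncard) := by
  have hcard : Nat.card (Set (Q × Q)) = 2 ^ (Q.ncard * Q.ncard) := by
    classical
    have := Fintype.ofFinite Q
    rw [Nat.card_eq_fintype_card, Fintype.card_set, Fintype.card_prod,
      ← Nat.card_eq_fintype_card, Nat.card_coe_set_eq]
  exact hcard ▸ Nat.card_le_card_of_injective _ (injective_transitionRel_out hstart hstep)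

theorem finite_quotient_syntacticCon (hL : L.IsRegular) : Finite (syntacticCon L).Quotient := by
  obtain ⟨σ, _, M, rfl⟩ := hL
  rw [← DFA.toNFA_correct]
  exact Finite.of_injective _
    (injective_transitionRel_out (Q := Set.univ) (Set.subset_univ _) fun _ _ => Set.subset_univ _)

end SyntacticMonoid

section Necessity

variable {A M : Type*} [Monoid M] {φ : FreeMonoid A →* M} {C D E : Set (Language A)}
  {K L : Language A} {u u' v v' w : FreeMonoid A}

/-- `v` can replace `u` in every word that belongs to a language of `D`. -/
def ContextLE (D : Set (Language A)) (u v : FreeMonoid A) : Prop :=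
  ∀ K ∈ D, ∀ x y, toList (x * u * y) ∈ K → toList (x * v * y) ∈ K

namespace ContextLE

theorem refl (u : FreeMonoid A) : ContextLE D u u := fun _ _ _ _ => id

theorem trans (h : ContextLE D u v) (h' : ContextLE D v w) : ContextLE D u w :=
  fun K hK x y => h' K hK x y ∘ h K hK x y

theorem mono (h : ContextLE D u v) (hED : E ⊆ D) : ContextLE E u v := fun K hK => h K (hED hK)

theorem mul (h : ContextLE D u v) (h' : ContextLE D u' v') :
    ContextLE D (u * u') (v * v') := fun K hK x y hx => by
  have := h K hK x (u' * y) (by simpa only [mul_assoc] using hx)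
  simpa only [mul_assoc] using h' K hK (x * v) y (by simpa only [mul_assoc] using this)

theorem pow_le (h : ContextLE D (u * u) u) : ∀ n ≠ 0, ContextLE D (u ^ n) u
  | 1, _ => pow_one u ▸ refl u
  | n + 2, _ => pow_succ u (n + 1) ▸ ((pow_le h (n + 1) n.succ_ne_zero).mul (refl u)).trans h

theorem of_syntacticCon (h : ∀ K ∈ D, syntacticCon K u v) : ContextLE D u v :=
  fun K hK x y => (h K hK x y).1

end ContextLE

/-- The words that lead into `L` when put between `x` and `y`. -/
def contextQuotient (L : Language A) (x y : FreeMonoid A) : Language A :=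
  {w | toList (x * ofList w * y) ∈ L}

/-- The context quotients of the languages of `D`. -/
def contextQuotients (D : Set (Language A)) : Set (Language A) :=
  {Q | ∃ K ∈ D, ∃ x y, contextQuotient K x y = Q}

theorem contextQuotients_subset (hC : IsQuotientingLatticeOfRegular C) (hDC : D ⊆ C) :
    contextQuotients D ⊆ C := by
  rintro _ ⟨K, hK, x, y, rfl⟩
  have := hC.leftQuotient_mem _ (hC.rightQuotient_mem K (hDC hK) (toList y)) (toList x)
  exact this

theorem contextQuotient_congr {x x' y y' : FreeMonoid A} (hx : syntacticCon K x x')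
    (hy : syntacticCon K y y') : contextQuotient K x y = contextQuotient K x' y' := by
  ext w
  have hx' := hx 1 (ofList w * y)
  have hy' := hy (x' * ofList w) 1
  simp only [one_mul, mul_one, ← mul_assoc] at hx' hy'
  exact hx'.trans hy'

theorem finite_contextQuotients (hD : D.Finite) (hreg : ∀ K ∈ D, K.IsRegular) :
    (contextQuotients D).Finite := by
  have hrange (K : Language A) (hK : K ∈ D) :
      (Set.range fun p : FreeMonoid A × FreeMonoid A => contextQuotient K p.1 p.2).Finite := by
    have := finite_quotient_syntacticCon (hreg K hK)
    let f (m : (syntacticCon K).Quotient × (syntacticCon K).Quotient) : Language A :=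
      contextQuotient K (Quotient.out m.1) (Quotient.out m.2)
    refine (Set.finite_range f).subset ?_
    rintro _ ⟨⟨x, y⟩, rfl⟩
    exact ⟨((x : (syntacticCon K).Quotient), (y : (syntacticCon K).Quotient)),
      contextQuotient_congr (Quotient.exact (Quotient.out_eq _))
        (Quotient.exact (Quotient.out_eq _))⟩
  refine (hD.biUnion hrange).subset ?_
  rintro _ ⟨K, hK, x, y, rfl⟩
  exact Set.mem_biUnion hK ⟨(x, y), rfl⟩

theorem mem_of_contextLE_closed (hC : IsQuotientingLatticeOfRegular C) (hD : D.Finite)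
    (hDC : D ⊆ C) (hL : ∀ u v, ContextLE D u v → toList u ∈ L → toList v ∈ L) : L ∈ C := by
  have hfin := finite_contextQuotients hD fun K hK => hC.regular K (hDC hK)
  let upperClosure (u : List A) : Language A := sInf {Q ∈ contextQuotients D | u ∈ Q}
  have hupper (u : List A) : upperClosure u ∈ C :=
    InfClosed.sInf_mem (fun K hK L hL => hC.inter_mem K hK L hL)
      (hfin.subset (Set.sep_subset _ _)) hC.top_mem
      ((Set.sep_subset _ _).trans (contextQuotients_subset hC hDC))
  have hL_eq : L = sSup (upperClosure '' L) := by
    refine le_antisymm (fun u hu => ?_) (sSup_le ?_)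
    · exact le_sSup (Set.mem_image_of_mem upperClosure hu) (Set.mem_sInter.2 fun Q hQ => hQ.2)
    · rintro _ ⟨u, hu, rfl⟩ v hv
      exact hL (ofList u) (ofList v) (fun K hK x y hx =>
        Set.mem_sInter.1 hv _ ⟨⟨K, hK, x, y, rfl⟩, hx⟩) hu
  rw [hL_eq]
  refine SupClosed.sSup_mem (fun K hK L hL => hC.union_mem K hK L hL) ?_ hC.bot_mem ?_
  · refine (hfin.finite_subsets.image sInf).subset ?_
    rintro _ ⟨u, -, rfl⟩
    exact ⟨_, Set.sep_subset _ _, rfl⟩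
  · rintro _ ⟨u, -, rfl⟩
    exact hupper u

theorem toList_mul_mem_marked_cases {p q : FreeMonoid A} {a : A}
    (h : toList (p * q) ∈ K * {[a]} * L) :
    (∃ r s, q = r * s ∧ toList (p * r) ∈ K ∧ toList s ∈ ({[a]} : Language A) * L) ∨
      ∃ r s, p = r * s ∧ toList r ∈ K * ({[a]} : Language A) ∧ toList (s * q) ∈ L := by
  obtain ⟨_, ⟨w₁, hw₁, _, rfl, rfl⟩, w₂, hw₂, h⟩ := h
  have h : w₁ ++ a :: w₂ = toList p ++ toList q := by simpa using h
  obtain ⟨s, hp, hs⟩ | ⟨r, rfl, hq⟩ := List.append_eq_append_iff.1 h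
  · obtain _ | ⟨b, s⟩ := s
    · have hp : toList p = w₁ := by simpa using hp
      exact Or.inl ⟨1, q, (one_mul q).symm, by rwa [mul_one, hp], [a], rfl, w₂, hw₂, hs⟩
    · obtain ⟨rfl, rfl⟩ := List.cons_eq_cons.1 hs
      exact Or.inr ⟨ofList (w₁ ++ [a]), ofList s, hp.trans (List.append_cons w₁ a s),
        Language.append_mem_mul hw₁ rfl, hw₂⟩
  · exact Or.inl ⟨ofList r, ofList (a :: w₂), hq, hw₁, [a], rfl, w₂, hw₂, rfl⟩

/-- When a large power of `u` occurs in a word of a marked concatenation, one of the two factors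
still contains a large power of `u`, to which induction applies. -/
theorem InPol.exists_insertion (hL : InPol C L) : ∃ D ⊆ C, D.Finite ∧ ∃ N, ∀ n ≥ N, ∀ u v,
    ContextLE D (u * u) u → ContextLE D u v → ∀ x y, toList (x * u ^ n * y) ∈ L →
      ∃ i j, toList (x * (u ^ i * v * u ^ j) * y) ∈ L := by
  induction hL with
  | base K hK =>
    refine ⟨{K}, Set.singleton_subset_iff.2 hK, Set.finite_singleton K, 1,
      fun n hn u v hu huv x y hx => ⟨0, 0, ?_⟩⟩
    rw [pow_zero, one_mul, mul_one]
    exact (hu.pow_le n (Nat.one_le_iff_ne_zero.1 hn)).trans huv K rfl x y hx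
  | union K L _ _ ihK ihL =>
    obtain ⟨D, hD, hDfin, N, hK⟩ := ihK
    obtain ⟨E, hE, hEfin, N', hL⟩ := ihL
    refine ⟨D ∪ E, Set.union_subset hD hE, hDfin.union hEfin, max N N', ?_⟩
    rintro n hn u v hu huv x y (hx | hx)
    · obtain ⟨i, j, h⟩ := hK n (le_of_max_le_left hn) u v (hu.mono Set.subset_union_left)
        (huv.mono Set.subset_union_left) x y hx
      exact ⟨i, j, Or.inl h⟩
    · obtain ⟨i, j, h⟩ := hL n (le_of_max_le_right hn) u v (hu.mono Set.subset_union_right)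
        (huv.mono Set.subset_union_right) x y hx
      exact ⟨i, j, Or.inr h⟩
  | markedConcat K L a _ _ ihK ihL =>
    obtain ⟨D, hD, hDfin, N, hK⟩ := ihK
    obtain ⟨E, hE, hEfin, N', hL⟩ := ihL
    refine ⟨D ∪ E, Set.union_subset hD hE, hDfin.union hEfin, N + N', ?_⟩
    intro n hn u v hu huv x y hx
    obtain ⟨k, hk, rfl⟩ : ∃ k ≥ N', n = N + k := ⟨n - N, by omega, by omega⟩
    rw [pow_add, ← mul_assoc x, mul_assoc _ _ y] at hx
    obtain ⟨r, s, hq, hr, hs⟩ | ⟨r, s, hp, hr, hs⟩ := toList_mul_mem_marked_cases hx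
    · obtain ⟨i, j, h⟩ := hK N le_rfl u v (hu.mono Set.subset_union_left)
        (huv.mono Set.subset_union_left) x r hr
      refine ⟨i, j + k, ?_⟩
      have := Language.append_mem_mul h hs
      rw [← mul_assoc, ← toList_mul, mul_assoc _ r, ← hq] at this
      simpa only [pow_add, mul_assoc] using this
    · rw [← mul_assoc] at hs
      obtain ⟨i, j, h⟩ := hL k hk u v (hu.mono Set.subset_union_right)
        (huv.mono Set.subset_union_right) s y hs
      refine ⟨N + i, j, ?_⟩
      have := Language.append_mem_mul hr h
      rw [← toList_mul, ← mul_assoc r, ← mul_assoc r, ← hp] at this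
      simpa only [pow_add, mul_assoc] using this

theorem ContextLE.exists_ne_zero_pow (hD : D.Finite) (hreg : ∀ K ∈ D, K.IsRegular)
    (u : FreeMonoid A) : ∃ n ≠ 0, ContextLE D (u ^ n * u ^ n) (u ^ n) := by
  have := hD.to_subtype
  have (K : D) : Finite (syntacticCon K.1).Quotient := finite_quotient_syntacticCon (hreg K K.2)
  let ψ : FreeMonoid A →* ∀ K : D, (syntacticCon K.1).Quotient :=
    MonoidHom.pi fun K => (syntacticCon K.1).mk'
  obtain ⟨n, hn, h⟩ := exists_ne_zero_isIdempotentElem_pow (ψ u)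
  rw [IsIdempotentElem, ← map_pow, ← map_mul] at h
  exact ⟨n, hn, of_syntacticCon fun K hK => syntacticCon_mk'_eq.1 (congrFun h ⟨K, hK⟩)⟩

/-- The insertion lemma is applied to a power of `e w e`, in which one factor `w` is replaced
by `w'`. -/
theorem InPol.exists_contextLE_replace (hreg : ∀ K ∈ C, K.IsRegular) (hL : InPol C L)
    (hφ : Recognizes φ L) : ∃ D ⊆ C, D.Finite ∧ ∀ e w w',
      IsIdempotentElem (φ e) → φ (e * w * e) = φ e → ContextLE D w w' →
        ∀ x y, toList (x * e * y) ∈ L → toList (x * (e * w' * e) * y) ∈ L := by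
  obtain ⟨D, hDC, hD, N, hN⟩ := hL.exists_insertion
  refine ⟨D, hDC, hD, fun e w w' he hew hww' x y hx => ?_⟩
  set z := e * w * e
  obtain ⟨n, hn, hidem⟩ := ContextLE.exists_ne_zero_pow hD (fun K hK => hreg K (hDC hK)) z
  have hle : ContextLE D (z ^ n) (e * w' * e * z ^ (n - 1)) := by
    rw [← mul_pow_sub_one hn]
    exact (((ContextLE.refl e).mul hww').mul (.refl e)).mul (.refl _)
  have hpow (k : ℕ) (hk : k ≠ 0) : φ (z ^ k) = φ e := by
    rw [map_pow, hew, he.pow_eq hk]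
  have hx_pow : toList (x * (z ^ n) ^ (N + 1) * y) ∈ L := by
    refine (hφ _ _ ?_).1 hx
    rw [← pow_mul, map_mul, map_mul, map_mul, map_mul, hpow _ (by positivity)]
  obtain ⟨i, j, h⟩ := hN (N + 1) (Nat.le_succ N) _ _ hidem hle x y hx_pow
  have hleft (k : ℕ) : φ z ^ k * φ e = φ e := by
    rw [hew, ← pow_succ, he.pow_eq k.succ_ne_zero]
  have hright (k : ℕ) : φ e * φ z ^ k = φ e := by
    rw [hew, ← pow_succ', he.pow_eq k.succ_ne_zero]
  have hvalue : φ ((z ^ n) ^ i * (e * w' * e * z ^ (n - 1)) * (z ^ n) ^ j) = φ (e * w' * e) :=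
    calc _ = φ z ^ (n * i) * φ e * φ w' * (φ e * φ z ^ (n - 1 + n * j)) := by
          simp only [map_mul, map_pow, pow_mul, pow_add, mul_assoc]
      _ = φ (e * w' * e) := by rw [hleft, hright, map_mul, map_mul]
  exact (hφ _ _ (by rw [map_mul, map_mul, hvalue, ← map_mul, ← map_mul])).1 h

theorem localStabilizer_mem (hC : IsQuotientingLatticeOfRegular C) (hL : InPol C L)
    (hLc : InPol C Lᶜ) {m : (syntacticCon L).Quotient} (hm : IsIdempotentElem m) :
    localStabilizer (syntacticCon L).mk' m ∈ C := by
  have hrec := recognizes_mk'_syntacticCon L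
  obtain ⟨D, hDC, hD, hDL⟩ := hL.exists_contextLE_replace hC.regular hrec
  obtain ⟨E, hEC, hE, hEL⟩ := hLc.exists_contextLE_replace hC.regular hrec.compl
  obtain ⟨e, rfl⟩ := (syntacticCon L).mk'_surjective m
  refine mem_of_contextLE_closed hC (hD.union hE) (Set.union_subset hDC hEC)
    fun w w' hww' (hw : _ = _) => ?_
  change _ = _
  rw [ofList_toList, ← map_mul, ← map_mul] at hw ⊢
  refine syntacticCon_mk'_eq.2 fun x y => ⟨?_, ?_⟩
  · exact not_imp_not.1
      (hEL e w w' hm hw (hww'.mono Set.subset_union_right) x y)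
  · exact hDL e w w' hm hw (hww'.mono Set.subset_union_left) x y

theorem mem_pol_inter_coPol_iff [Finite A] (hC : IsQuotientingLatticeOfRegular C)
    (hL : L.IsRegular) : L ∈ Pol C ∩ coPol C ↔ ∀ e : (syntacticCon L).Quotient,
      IsIdempotentElem e → localStabilizer (syntacticCon L).mk' e ∈ C := by
  refine ⟨fun h e he => localStabilizer_mem hC h.1 h.2 he, fun h => ?_⟩
  have := finite_quotient_syntacticCon hL
  have hquot (K : Language A) (hK : K ∈ C) (a : A) := hC.leftQuotient_mem K hK [a]
  have hrec := recognizes_mk'_syntacticCon L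
  exact ⟨.of_localStabilizer_mem hC.bot_mem hquot h hrec,
    .of_localStabilizer_mem hC.bot_mem hquot h hrec.compl⟩

end Necessity

section Codes

/-- An enumeration of the alphabet. -/
noncomputable def alphabetList (A : Type*) [Finite A] : List A :=
  (Set.finite_univ (α := A)).toFinset.toList

theorem mem_alphabetList {A : Type*} [Finite A] (a : A) : a ∈ alphabetList A := by
  simp [alphabetList]

/-- The words of length at most `n`. -/
noncomputable def wordsUpTo (A : Type*) [Finite A] : ℕ → List (List A)
  | 0 => [[]]
  | n + 1 => [] :: (wordsUpTo A n).flatMap fun w => (alphabetList A).map fun a => a :: w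

theorem mem_wordsUpTo {A : Type*} [Finite A] {n : ℕ} {w : List A} :
    w ∈ wordsUpTo A n ↔ w.length ≤ n := by
  induction n generalizing w with
  | zero => simp [wordsUpTo]
  | succ n ih => cases w <;> simp [wordsUpTo, ih, mem_alphabetList]

namespace NFACode

variable {A : Type*} {c : NFACode A}

/-- One step of the subset construction, on lists. -/
noncomputable def stepList (c : NFACode A) (S : List ℕ) (a : A) : List ℕ :=
  open Classical in (c.2.1.filter fun t => t.1 ∈ S ∧ t.2.1 = a).map fun t => t.2.2

theorem mem_stepList {S : List ℕ} {a : A} {q : ℕ} :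
    q ∈ c.stepList S a ↔ ∃ p ∈ S, (p, a, q) ∈ c.2.1 := by
  simp only [stepList, List.mem_map, List.mem_filter, decide_eq_true_eq, Prod.exists]
  exact ⟨fun ⟨p, _, _, ⟨h, hp, rfl⟩, rfl⟩ => ⟨p, hp, h⟩,
    fun ⟨p, hp, h⟩ => ⟨p, a, q, ⟨h, hp, rfl⟩, rfl⟩⟩

theorem mem_foldl_stepList {w : List A} {S : List ℕ} {q : ℕ} :
    q ∈ w.foldl c.stepList S ↔ q ∈ c.toNFA.evalFrom {p | p ∈ S} w := by
  induction w generalizing S with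
  | nil => rfl
  | cons a w ih =>
    have hstep : {p | p ∈ c.stepList S a} = c.toNFA.stepSet {p | p ∈ S} a := by
      ext p
      rw [NFA.mem_stepSet]
      exact mem_stepList
    rw [List.foldl_cons, ih, NFA.evalFrom_cons, hstep]

theorem mem_language_iff {w : List A} :
    w ∈ c.language ↔ ∃ q ∈ c.2.2, q ∈ w.foldl c.stepList c.1 := by
  simp only [mem_foldl_stepList]
  exact NFA.mem_accepts

/-- The class of a word in the syntactic monoid of the language of `c`. -/
def syntacticClass (c : NFACode A) (w : List A) : (syntacticCon c.language).Quotient :=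
  (syntacticCon c.language).mk' (ofList w)

theorem syntacticClass_append (u v : List A) :
    c.syntacticClass (u ++ v) = c.syntacticClass u * c.syntacticClass v := rfl

theorem mem_language_congr {u v : List A} (h : c.syntacticClass u = c.syntacticClass v) :
    u ∈ c.language ↔ v ∈ c.language :=
  recognizes_mk'_syntacticCon c.language (ofList u) (ofList v) h

/-- A bound for the size of the syntactic monoid of the language of `c`. -/
def bound (c : NFACode A) : ℕ :=
  2 ^ ((c.1.length + c.2.1.length) * (c.1.length + c.2.1.length))

theorem card_quotient_syntacticCon_language_le (c : NFACode A) :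
    Nat.card (syntacticCon c.language).Quotient ≤ c.bound := by
  classical
  let Q : Finset ℕ := (c.1 ++ c.2.1.map fun t => t.2.2).toFinset
  have hQ : (Q : Set ℕ).ncard ≤ c.1.length + c.2.1.length := by
    rw [Set.ncard_coe_finset]
    exact (List.toFinset_card_le _).trans_eq (by rw [List.length_append, List.length_map])
  refine (card_quotient_syntacticCon_accepts_le (Q := (Q : Set ℕ)) (fun q hq => ?_)
    fun p a q hq => ?_).trans (Nat.pow_le_pow_right two_pos (Nat.mul_le_mul hQ hQ))
  · exact List.mem_toFinset.2 (List.mem_append_left _ hq)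
  · exact List.mem_toFinset.2 (List.mem_append_right _ (List.mem_map.2 ⟨_, hq, rfl⟩))

variable [Finite A]

/-- Words that represent all the syntactic classes of the language of `c`. -/
noncomputable def representatives (c : NFACode A) : List (List A) := wordsUpTo A c.bound

theorem exists_mem_representatives (c : NFACode A) (m : (syntacticCon c.language).Quotient) :
    ∃ v ∈ c.representatives, c.syntacticClass v = m := by
  have := finite_quotient_syntacticCon ((isRegular_iff_exists_code _).2 ⟨c, rfl⟩)
  obtain ⟨w, rfl⟩ := (syntacticCon c.language).mk'_surjective m
  obtain ⟨v, hv, hvw⟩ := exists_length_lt_card_map_eq (syntacticCon c.language).mk' w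
  exact ⟨toList v, mem_wordsUpTo.2 (hv.le.trans c.card_quotient_syntacticCon_language_le), hvw⟩

theorem syntacticClass_eq_iff {u v : List A} : c.syntacticClass u = c.syntacticClass v ↔
    ∀ x ∈ c.representatives, ∀ y ∈ c.representatives,
      (x ++ u ++ y ∈ c.language ↔ x ++ v ++ y ∈ c.language) := by
  refine ⟨fun h x _ y _ => mem_language_congr (by simp only [syntacticClass_append, h]),
    fun h => syntacticCon_mk'_eq.2 fun x y => ?_⟩
  obtain ⟨x', hx', hx⟩ := c.exists_mem_representatives (c.syntacticClass (toList x))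
  obtain ⟨y', hy', hy⟩ := c.exists_mem_representatives (c.syntacticClass (toList y))
  have hcongr (w : List A) : x' ++ w ++ y' ∈ c.language ↔ toList x ++ w ++ toList y ∈ c.language :=
    mem_language_congr (by simp only [syntacticClass_append, hx, hy])
  exact (hcongr u).symm.trans ((h x' hx' y' hy').trans (hcongr v))

variable [Encodable A]

/-- The transitions `(u, a, v)` such that `u a` and `v` have the same class, between the codes of
the representatives. -/
noncomputable def classTransitions (c : NFACode A) : List (ℕ × A × ℕ) :=
  open Classical in
  c.representatives.flatMap fun u => (alphabetList A).flatMap fun a =>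
    (c.representatives.filter fun v => c.syntacticClass (u ++ [a]) = c.syntacticClass v).map
      fun v => (Encodable.encode u, a, Encodable.encode v)

theorem mem_classTransitions {p q : ℕ} {a : A} :
    (p, a, q) ∈ c.classTransitions ↔ ∃ u ∈ c.representatives, ∃ v ∈ c.representatives,
      c.syntacticClass (u ++ [a]) = c.syntacticClass v ∧
        Encodable.encode u = p ∧ Encodable.encode v = q := by
  simp only [classTransitions, List.mem_flatMap, List.mem_map, List.mem_filter,
    decide_eq_true_eq, Prod.mk.injEq]
  constructor
  · rintro ⟨u, hu, b, -, v, ⟨hv, h⟩, rfl, rfl, rfl⟩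
    exact ⟨u, hu, v, hv, h, rfl, rfl⟩
  · rintro ⟨u, hu, v, hv, h, rfl, rfl⟩
    exact ⟨u, hu, a, mem_alphabetList a, v, ⟨hv, h⟩, rfl, rfl, rfl⟩

/-- An automaton for the local stabilizer of the class of `e`. After reading `w`, it is in the
states that encode the representatives of the class of `w`. -/
noncomputable def stabilizer (c : NFACode A) (e : List A) : NFACode A :=
  open Classical in
  ((c.representatives.filter fun v => c.syntacticClass [] = c.syntacticClass v).map
      Encodable.encode,
    c.classTransitions,
    (c.representatives.filter fun v => c.syntacticClass (e ++ v ++ e) = c.syntacticClass e).map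
      Encodable.encode)

theorem mem_eval_stabilizer {e w : List A} {q : ℕ} : q ∈ (c.stabilizer e).toNFA.eval w ↔
    ∃ v ∈ c.representatives, c.syntacticClass w = c.syntacticClass v ∧
      Encodable.encode v = q := by
  induction w using List.reverseRecOn generalizing q with
  | nil =>
    change q ∈ (c.stabilizer e).1 ↔ _
    simp only [stabilizer, List.mem_map, List.mem_filter, decide_eq_true_eq, and_assoc]
  | append_singleton w a ih =>
    have hstep (p : ℕ) : q ∈ (c.stabilizer e).toNFA.step p a ↔ (p, a, q) ∈ c.classTransitions :=
      Iff.rfl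
    simp only [NFA.eval_append_singleton, NFA.mem_stepSet, ih, hstep, mem_classTransitions,
      syntacticClass_append]
    constructor
    · rintro ⟨_, ⟨u, -, hwu, rfl⟩, u', -, v, hv, huv, huu', rfl⟩
      obtain rfl := Encodable.encode_injective huu'
      exact ⟨v, hv, by rw [hwu, huv], rfl⟩
    · rintro ⟨v, hv, hwv, rfl⟩
      obtain ⟨u, hu, huw⟩ := c.exists_mem_representatives (c.syntacticClass w)
      exact ⟨_, ⟨u, hu, huw.symm, rfl⟩, u, hu, v, hv, by rw [huw, hwv], rfl, rfl⟩

theorem mem_accept_stabilizer {e : List A} {q : ℕ} : q ∈ (c.stabilizer e).toNFA.accept ↔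
    ∃ v ∈ c.representatives, c.syntacticClass (e ++ v ++ e) = c.syntacticClass e ∧
      Encodable.encode v = q := by
  change q ∈ (c.stabilizer e).2.2 ↔ _
  simp only [stabilizer, List.mem_map, List.mem_filter, decide_eq_true_eq, and_assoc]

theorem language_stabilizer (c : NFACode A) (e : List A) : (c.stabilizer e).language =
    localStabilizer (syntacticCon c.language).mk' (c.syntacticClass e) := by
  ext w
  change (∃ q ∈ (c.stabilizer e).toNFA.accept, q ∈ (c.stabilizer e).toNFA.eval w) ↔
    c.syntacticClass e * c.syntacticClass w * c.syntacticClass e = c.syntacticClass e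
  simp only [mem_accept_stabilizer, mem_eval_stabilizer, syntacticClass_append]
  constructor
  · rintro ⟨_, ⟨v, -, hv, rfl⟩, v', -, hwv', hvv'⟩
    obtain rfl := Encodable.encode_injective hvv'
    rw [hwv', hv]
  · intro hw
    obtain ⟨v, hv, hvw⟩ := c.exists_mem_representatives (c.syntacticClass w)
    exact ⟨_, ⟨v, hv, by rw [hvw, hw], rfl⟩, v, hv, hvw.symm, rfl⟩

/-- Automata for the local stabilizers of the idempotents of the syntactic monoid. -/
noncomputable def stabilizers (c : NFACode A) : List (NFACode A) :=
  open Classical in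
  (c.representatives.filter fun e => c.syntacticClass (e ++ e) = c.syntacticClass e).map
    c.stabilizer

theorem mem_pol_inter_coPol_iff {C : Set (Language A)} (hC : IsQuotientingLatticeOfRegular C)
    (c : NFACode A) :
    c.language ∈ Pol C ∩ coPol C ↔ ∀ d ∈ c.stabilizers, d.language ∈ C := by
  rw [_root_.mem_pol_inter_coPol_iff hC ((isRegular_iff_exists_code _).2 ⟨c, rfl⟩)]
  simp only [stabilizers, List.forall_mem_map, List.mem_filter, decide_eq_true_eq,
    language_stabilizer]
  refine ⟨fun h e he => h _ he.2, fun h m hm => ?_⟩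
  obtain ⟨e, he, rfl⟩ := c.exists_mem_representatives m
  exact h e ⟨he, hm⟩

end NFACode

end Codes

section Computability

variable {α β : Type*} [Primcodable α] [Primcodable β]

theorem primrecRel_list_mem : PrimrecRel fun (a : α) (l : List α) => a ∈ l :=
  ((Primrec.eq (α := α)).exists_mem_list.comp Primrec.snd Primrec.fst).of_eq fun p => by simp

theorem primrecPred_iff {p q : α → Prop} (hp : PrimrecPred p) (hq : PrimrecPred q) :
    PrimrecPred fun a => p a ↔ q a :=
  ((hp.and hq).or (hp.not.and hq.not)).of_eq fun _ => by tauto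

theorem primrec_two_pow : Primrec fun n : ℕ => 2 ^ n :=
  (Primrec.nat_rec₁ (f := fun _ k => k * 2) 1
    (Primrec.nat_mul.comp Primrec.snd (Primrec.const 2))).of_eq fun n => by
      induction n with
      | zero => rfl
      | succ n ih => rw [pow_succ, ← ih]

theorem primrec_wordsUpTo [Finite α] : Primrec (wordsUpTo α) := by
  refine (Primrec.nat_rec₁ (f := fun _ W => [] :: W.flatMap fun w =>
    (alphabetList α).map fun a => a :: w) [[]] ?_).of_eq fun n => ?_
  · exact Primrec.list_cons.comp (Primrec.const []) (Primrec.list_flatMap Primrec.snd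
      (Primrec.list_map (Primrec.const _)
        (Primrec.list_cons.comp Primrec.snd (Primrec.snd.comp Primrec.fst))))
  · induction n with
    | zero => rfl
    | succ n ih => simp only [wordsUpTo, ← ih]

theorem computablePred_forall_mem_list {p : α → Prop} (hp : ComputablePred p) :
    ComputablePred fun l : List α => ∀ a ∈ l, p a := by
  classical
  have hstep : Computable₂ fun (l : List α) (q : ℕ × Bool) =>
      ((l[q.1]?.map fun a => decide (p a)).getD true && q.2) :=
    Primrec.and.to_comp.comp
      (Computable.option_getD
        (Computable.option_map (Computable.list_getElem?.comp Computable.fst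
          (Computable.fst.comp Computable.snd)) (hp.decide.comp Computable.snd))
        (Computable.const true))
      (Computable.snd.comp Computable.snd)
  refine Computable.computablePred ((Computable.nat_rec Computable.list_length
    (Computable.const true) hstep).of_eq fun l => ?_)
  have hprefix (n : ℕ) : (Nat.rec true (fun i b =>
      ((l[i]?.map fun a => decide (p a)).getD true && b)) n : Bool) = true ↔
      ∀ i < n, ∀ a, l[i]? = some a → p a := by
    induction n with
    | zero => simp
    | succ n ih =>
      rw [Nat.forall_lt_succ_right, ← ih, and_comm]
      cases h : l[n]? <;> simp [h]
  rw [Bool.eq_iff_iff, decide_eq_true_iff]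
  refine (hprefix l.length).trans
    ⟨fun h a ha => ?_, fun h i _ a ha => h a (List.mem_of_getElem? ha)⟩
  obtain ⟨i, hi, rfl⟩ := List.getElem_of_mem ha
  exact h i hi _ (List.getElem?_eq_getElem hi)

namespace NFACode

variable {A : Type*} [Primcodable A]

theorem primrec_stepList :
    Primrec fun p : NFACode A × List ℕ × A => p.1.stepList p.2.1 p.2.2 := by
  classical
  have hR : PrimrecRel fun (t : ℕ × A × ℕ) (b : List ℕ × A) => t.1 ∈ b.1 ∧ t.2.1 = b.2 :=
    (primrecRel_list_mem.comp (Primrec.fst.comp Primrec.fst)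
      (Primrec.fst.comp Primrec.snd)).and
      (Primrec.eq.comp (Primrec.fst.comp (Primrec.snd.comp Primrec.fst))
        (Primrec.snd.comp Primrec.snd))
  refine (Primrec.list_map (hR.listFilter.comp (Primrec.fst.comp (Primrec.snd.comp Primrec.fst))
    Primrec.snd) (g := fun _ t => t.2.2)
    (Primrec.snd.comp (Primrec.snd.comp Primrec.snd)).to₂).of_eq fun p => ?_
  simp only [stepList]

theorem primrecRel_mem_language :
    PrimrecRel fun (w : List A) (c : NFACode A) => w ∈ c.language := by
  have hrun : Primrec fun p : List A × NFACode A => p.1.foldl p.2.stepList p.2.1 :=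
    Primrec.list_foldl (h := fun (p : List A × NFACode A) (q : List ℕ × A) =>
        p.2.stepList q.1 q.2) Primrec.fst
      (Primrec.fst.comp Primrec.snd)
      (primrec_stepList.comp
        (Primrec.pair (Primrec.snd.comp Primrec.fst) Primrec.snd)).to₂
  exact (primrecRel_list_mem.exists_mem_list.comp
    (Primrec.snd.comp (Primrec.snd.comp Primrec.snd)) hrun).of_eq fun _ => mem_language_iff.symm

theorem primrec_bound : Primrec (bound : NFACode A → ℕ) := by
  have hlen : Primrec fun c : NFACode A => c.1.length + c.2.1.length :=
    Primrec.nat_add.comp (Primrec.list_length.comp Primrec.fst)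
      (Primrec.list_length.comp (Primrec.fst.comp Primrec.snd))
  exact primrec_two_pow.comp (Primrec.nat_mul.comp hlen hlen)

theorem primrecRel_mem_language_iff : PrimrecRel
    fun (y : List A) (p : List A × NFACode A × List A × List A) =>
      (p.1 ++ p.2.2.1 ++ y ∈ p.2.1.language ↔ p.1 ++ p.2.2.2 ++ y ∈ p.2.1.language) := by
  have hx : Primrec fun p : List A × List A × NFACode A × List A × List A => p.2.1 :=
    Primrec.fst.comp Primrec.snd
  have hc : Primrec fun p : List A × List A × NFACode A × List A × List A => p.2.2.1 :=
    Primrec.fst.comp (Primrec.snd.comp Primrec.snd)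
  have huv : Primrec fun p : List A × List A × NFACode A × List A × List A => p.2.2.2 :=
    Primrec.snd.comp (Primrec.snd.comp Primrec.snd)
  exact primrecPred_iff
    (primrecRel_mem_language.comp (Primrec.list_append.comp
      (Primrec.list_append.comp hx (Primrec.fst.comp huv)) Primrec.fst) hc)
    (primrecRel_mem_language.comp (Primrec.list_append.comp
      (Primrec.list_append.comp hx (Primrec.snd.comp huv)) Primrec.fst) hc)

variable [Finite A]

theorem primrec_representatives : Primrec (representatives : NFACode A → List (List A)) :=
  primrec_wordsUpTo.comp primrec_bound

theorem primrecPred_syntacticClass_eq {f : α → NFACode A} {u v : α → List A} (hf : Primrec f)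
    (hu : Primrec u) (hv : Primrec v) :
    PrimrecPred fun a => (f a).syntacticClass (u a) = (f a).syntacticClass (v a) := by
  have hy : PrimrecRel fun (x : List A) (p : NFACode A × List A × List A) =>
      ∀ y ∈ p.1.representatives,
        (x ++ p.2.1 ++ y ∈ p.1.language ↔ x ++ p.2.2 ++ y ∈ p.1.language) :=
    primrecRel_mem_language_iff.forall_mem_list.comp
      (primrec_representatives.comp (Primrec.fst.comp Primrec.snd))
      (Primrec.pair Primrec.fst Primrec.snd)
  exact (hy.forall_mem_list.comp (primrec_representatives.comp hf)
    (Primrec.pair hf (Primrec.pair hu hv))).of_eq fun _ => syntacticClass_eq_iff.symm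

theorem primrec_classTransitions :
    Primrec (classTransitions : NFACode A → List (ℕ × A × ℕ)) := by
  classical
  have hR : PrimrecRel fun (v : List A) (b : (NFACode A × List A) × A) =>
      b.1.1.syntacticClass (b.1.2 ++ [b.2]) = b.1.1.syntacticClass v :=
    primrecPred_syntacticClass_eq (Primrec.fst.comp (Primrec.fst.comp Primrec.snd))
      (Primrec.list_concat.comp (Primrec.snd.comp (Primrec.fst.comp Primrec.snd))
        (Primrec.snd.comp Primrec.snd)) Primrec.fst
  have htargets : Primrec fun b : (NFACode A × List A) × A =>
      b.1.1.representatives.filter fun v =>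
        b.1.1.syntacticClass (b.1.2 ++ [b.2]) = b.1.1.syntacticClass v :=
    hR.listFilter.comp (primrec_representatives.comp (Primrec.fst.comp Primrec.fst)) Primrec.id
  have htriple : Primrec₂ fun (b : (NFACode A × List A) × A) (v : List A) =>
      (Encodable.encode b.1.2, b.2, Encodable.encode v) :=
    (Primrec.pair (Primrec.encode.comp (Primrec.snd.comp (Primrec.fst.comp Primrec.fst)))
      (Primrec.pair (Primrec.snd.comp Primrec.fst) (Primrec.encode.comp Primrec.snd))).to₂
  refine (Primrec.list_flatMap primrec_representatives (Primrec.list_flatMap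
    (Primrec.const (alphabetList A)) (Primrec.list_map htargets htriple).to₂).to₂).of_eq
      fun c => ?_
  simp only [classTransitions]

theorem primrec_stabilizer : Primrec₂ (stabilizer : NFACode A → List A → NFACode A) := by
  classical
  have hstart : PrimrecRel fun (v : List A) (p : NFACode A × List A) =>
      p.1.syntacticClass [] = p.1.syntacticClass v :=
    primrecPred_syntacticClass_eq (Primrec.fst.comp Primrec.snd) (Primrec.const []) Primrec.fst
  have he : Primrec fun p : List A × NFACode A × List A => p.2.2 :=
    Primrec.snd.comp Primrec.snd
  have haccept : PrimrecRel fun (v : List A) (p : NFACode A × List A) =>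
      p.1.syntacticClass (p.2 ++ v ++ p.2) = p.1.syntacticClass p.2 :=
    primrecPred_syntacticClass_eq (Primrec.fst.comp Primrec.snd)
      (Primrec.list_append.comp (Primrec.list_append.comp he Primrec.fst) he) he
  have hreps : Primrec fun p : NFACode A × List A => p.1.representatives :=
    primrec_representatives.comp Primrec.fst
  refine (Primrec.pair
    (Primrec.list_map (hstart.listFilter.comp hreps Primrec.id)
      (Primrec.encode.comp Primrec.snd).to₂)
    (Primrec.pair (primrec_classTransitions.comp Primrec.fst)
      (Primrec.list_map (haccept.listFilter.comp hreps Primrec.id)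
        (Primrec.encode.comp Primrec.snd).to₂))).of_eq fun p => ?_
  simp only [stabilizer, id]

theorem primrec_stabilizers : Primrec (stabilizers : NFACode A → List (NFACode A)) := by
  classical
  have hidem : PrimrecRel fun (e : List A) (c : NFACode A) =>
      c.syntacticClass (e ++ e) = c.syntacticClass e :=
    primrecPred_syntacticClass_eq Primrec.snd (Primrec.list_append.comp Primrec.fst Primrec.fst)
      Primrec.fst
  refine (Primrec.list_map (hidem.listFilter.comp primrec_representatives Primrec.id)
    primrec_stabilizer).of_eq fun c => ?_
  simp only [stabilizers, id]

end NFACode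

end Computability

theorem mainTheorem4 {A : Type*} [Finite A] [Primcodable A] (C : Set (Language A))
    (hC : IsQuotientingLatticeOfRegular C) (hdec : MembershipDecidable C) :
    MembershipDecidable (Pol C ∩ coPol C) := by
  classical
  refine Computable.computablePred
    ((computablePred_forall_mem_list hdec).decide.comp
      (NFACode.primrec_stabilizers (A := A)).to_comp |>.of_eq fun c => ?_)
  exact decide_eq_decide.2 (c.mem_pol_inter_coPol_iff hC).symm
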